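/- For $k\ge 0$ let $P_k$ be the Legendre polynomial of degree $k$, and let $C_k^{(a)}$, $a\in\{-\tfrac12,-\tfrac32\}$, be the ultraspherical polynomials, given by $C_0^{(a)}(x)=1$, $C_1^{(a)}(x)=2ax$ and $(n+2)C_{n+2}^{(a)}(x)=2(n+1+a)xC_{n+1}^{(a)}(x)-(n+2a)C_n^{(a)}(x)$. Let $\log$ be the principal logarithm, with $\arg\in(-\pi,\pi]$, and $0\log 0=0$. Let $\log_- w=\log|w|-\mathrm i\pi$ if $w$ is a negative real number, and $\log_- w=\log w$ otherwise. Let $\delta$ be the Kronecker delta. For $z=x+\mathrm iy\in\mathbb C$ put $$L_k(z)=\int_{-1}^1\log(z-t)P_k(t)\,dt,\qquad M_k(z)=\int_{-1}^1\log(z-\mathrm it)P_k(t)\,dt,\qquad L_{-1}=M_{-1}=0,$$ $$L_{kj}(z)=\iint_{[-1,1]^2}\log\bigl(z-(s+\mathrm it)\bigr)P_k(s)P_j(t)\,ds\,dt,\qquad L(z)=\bigl(L_{kj}(z)\bigr)_{k,j\ge0},$$ $$\lambda_0(z)=(z-1)\log(z-1)+(z+1)\log(z+1),\quad \lambda_1(z)=-\tfrac23,\quad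 \lambda_k(z)=0\ (k\ge2),$$ $$\mu_k(z)=\delta_{k0}\bigl[(z-\mathrm i)\log(z-\mathrm i)+(z+\mathrm i)\log_-(z+\mathrm i)\bigr]-\tfrac{2\mathrm i}{3}\delta_{k1}-\begin{cases}2\mathrm i\pi x\,C_{k+1}^{(-1/2)}(y)& x<0,\ -1<y<1\\0&\text{otherwise,}\end{cases}$$ $$\beta_{kj}(z)=2\mathrm i\pi\, C_{j+1}^{(-1/2)}(y)\begin{cases}\tfrac13C_{k+2}^{(-3/2)}(x)-\delta_{k0}x+\tfrac13\delta_{k1}& -1\le x\le1,\ -1\le y<1\\-2x\,\delta_{k0}+\tfrac23\delta_{k1}&x<-1,\ -1\le y<1\\0&\text{otherwise.}\end{cases}$$ Define infinite matrices $F^{(1)}(z)$, $F^{(2)}(z)$ (rows $k\ge0$, columns $j\ge0$) by $$F^{(1)}_{0j}(z)=\mathrm i\,\frac{M_{j+1}(z-1)+M_{j+1}(z+1)-M_{j-1}(z-1)-M_{j-1}(z+1)}{2j+1}+\mu_j(z-1)+\mu_j(z+1),$$ $F^{(1)}_{10}(z)=-\tfrac43$, and $F^{(1)}_{kj}(z)=0$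 for all other $(k,j)$; $$F^{(2)}_{k0}(z)=\frac{L_{k+1}(z-\mathrm i)+L_{k+1}(z+\mathrm i)-L_{k-1}(z-\mathrm i)-L_{k-1}(z+\mathrm i)}{2k+1}+\lambda_k(z-\mathrm i)+\lambda_k(z+\mathrm i)+\beta_{k0}(z),$$ $F^{(2)}_{01}(z)=-\tfrac{4\mathrm i}{3}+\beta_{01}(z)$, and $F^{(2)}_{kj}(z)=\beta_{kj}(z)$ for all other $(k,j)$. Let $F(z)=F^{(2)}(z)-F^{(1)}(z)$. Let $A$ and $B$ be the infinite tridiagonal matrices with zero diagonal and with $$A_{k,k-1}=\frac{k-1}{2k+1},\quad A_{k,k+1}=\frac{k+2}{2k+1},\quad B_{k,k-1}=\frac{k}{2k+1},\quad B_{k,k+1}=\frac{k+1}{2k+1},$$ and let $C=A-B$. **Theorem.** The matrix $C$ is tridiagonal with zero diagonal, $C_{k,k-1}=-\frac1{2k+1}$ for $k\ge1$ and $C_{k,k+1}=\frac1{2k+1}$ for $k\ge0$. For every $z\in\mathbb C$ the integrals $L_{kj}(z)$ converge absolutely, the Sylvester equation $$C\,L(z)-\mathrm i\,L(z)\,C^\top=F(z)$$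 holds, and $F(z)$ has rank at most $3$ (the span of its columns has dimension at most $3$). -/

import Mathlib

noncomputable section

namespace LogSquare

open MeasureTheory

/-- The Legendre polynomials `P_k`, as functions on `ℝ`, through their three-term recurrence
`(n + 2) P_{n+2}(x) = (2n + 3) x P_{n+1}(x) - (n + 1) P_n(x)`, `P_0 = 1`, `P_1 = x`. -/
def legendre : ℕ → ℝ → ℝ
  | 0, _ => 1
  | 1, x => x
  | n + 2, x =>
      ((2 * (n : ℝ) + 3) * x * legendre (n + 1) x - ((n : ℝ) + 1) * legendre n x) / ((n : ℝ) + 2)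

/-- The ultraspherical polynomials `C_k^{(a)}`, through their three-term recurrence
`(n + 2) C_{n+2}(x) = 2 (n + 1 + a) x C_{n+1}(x) - (n + 2 a) C_n(x)`, `C_0 = 1`, `C_1 = 2 a x`.
It is valid for every `a ≠ 0`; here it is used for `a = -1/2` and `a = -3/2`. -/
def ultraspherical (a : ℝ) : ℕ → ℝ → ℝ
  | 0, _ => 1
  | 1, x => 2 * a * x
  | n + 2, x =>
      (2 * ((n : ℝ) + 1 + a) * x * ultraspherical a (n + 1) x
        - ((n : ℝ) + 2 * a) * ultraspherical a n x) / ((n : ℝ) + 2)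

/-- `u_{n-1}`, with the convention `u_{-1} = 0`. -/
def prev (u : ℕ → ℂ) : ℕ → ℂ
  | 0 => 0
  | n + 1 => u n

/-! Integrals over the interval -/

/-- `L_k(z) = ∫_{-1}^1 log(z - t) P_k(t) dt`, principal branch with `arg` in `(-π, π]`. -/
def L1 (k : ℕ) (z : ℂ) : ℂ :=
  ∫ t in (-1 : ℝ)..1, Complex.log (z - (t : ℂ)) * (legendre k t : ℂ)

/-- `M_k(z) = ∫_{-1}^1 log(z - i t) P_k(t) dt`. -/
def M1 (k : ℕ) (z : ℂ) : ℂ :=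
  ∫ t in (-1 : ℝ)..1, Complex.log (z - Complex.I * (t : ℂ)) * (legendre k t : ℂ)

/-! Integrals over the square -/

/-- The square `Ω = [-1, 1]²`. -/
def square : Set (ℝ × ℝ) := Set.Icc (-1 : ℝ) 1 ×ˢ Set.Icc (-1 : ℝ) 1

/-- `log(z - (s + i t)) P_k(s) P_j(t)` at `p = (s, t)`. -/
def logIntegrand (k j : ℕ) (z : ℂ) (p : ℝ × ℝ) : ℂ :=
  Complex.log (z - ((p.1 : ℂ) + Complex.I * (p.2 : ℂ)))
    * ((legendre k p.1 : ℂ) * (legendre j p.2 : ℂ))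

/-- The infinite matrix `L(z)`, with entry
`L_{kj}(z) = ∬_Ω log(z - (s + i t)) P_k(s) P_j(t) ds dt` in row `k` and column `j`. -/
def L (z : ℂ) : Matrix ℕ ℕ ℂ :=
  Matrix.of fun k j => ∫ p in square, logIntegrand k j z p

/-! The tridiagonal matrices -/

/-- Subdiagonal `(k - 1)/(2k + 1)`, superdiagonal `(k + 2)/(2k + 1)` in row `k`. -/
def A : Matrix ℕ ℕ ℂ :=
  Matrix.of fun k n =>
    if k = n + 1 then ((k : ℂ) - 1) / (2 * (k : ℂ) + 1)
    else if n = k + 1 then ((k : ℂ) + 2) / (2 * (k : ℂ) + 1)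
    else 0

/-- Subdiagonal `k/(2k + 1)`, superdiagonal `(k + 1)/(2k + 1)` in row `k`. -/
def B : Matrix ℕ ℕ ℂ :=
  Matrix.of fun k n =>
    if k = n + 1 then (k : ℂ) / (2 * (k : ℂ) + 1)
    else if n = k + 1 then ((k : ℂ) + 1) / (2 * (k : ℂ) + 1)
    else 0

def C : Matrix ℕ ℕ ℂ := A - B

/-- The product of infinite matrices. It is only used where one factor is tridiagonal, so that
each of the series has at most three nonzero terms. -/
def infMul (X Y : Matrix ℕ ℕ ℂ) : Matrix ℕ ℕ ℂ :=
  Matrix.of fun k j => ∑' n, X k n * Y n j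

/-! The right-hand side -/

/-- The logarithm with the other limit along its branch cut. -/
def logMinus (z : ℂ) : ℂ :=
  if z.im = 0 ∧ z.re < 0 then (Real.log ‖z‖ : ℂ) - Complex.I * (Real.pi : ℂ) else Complex.log z

/-- The inhomogeneity `λ_k(z)` of the recurrence for `L_k(z)`. -/
def lam (k : ℕ) (z : ℂ) : ℂ :=
  if k = 0 then (z - 1) * Complex.log (z - 1) + (z + 1) * Complex.log (z + 1)
  else if k = 1 then -2 / 3
  else 0

/-- The inhomogeneity `μ_k(z)` of the recurrence for `M_k(z)`. -/
def mu (k : ℕ) (z : ℂ) : ℂ :=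
  (if k = 0 then (z - Complex.I) * Complex.log (z - Complex.I)
      + (z + Complex.I) * logMinus (z + Complex.I)
    else if k = 1 then -(2 * Complex.I) / 3
    else 0)
  - (if z.re < 0 ∧ -1 < z.im ∧ z.im < 1 then
      2 * Complex.I * (Real.pi : ℂ) * (z.re : ℂ) * (ultraspherical (-1 / 2) (k + 1) z.im : ℂ)
    else 0)

/-- The branch-cut contribution `β_{kj}(z)`, `z = x + i y`. The bottom line `y = -1` is included
and the top line `y = 1` is not, in agreement with the principal branch of the logarithm. -/
def beta (k j : ℕ) (z : ℂ) : ℂ :=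
  2 * Complex.I * (Real.pi : ℂ) * (ultraspherical (-1 / 2) (j + 1) z.im : ℂ) *
    (if (-1 ≤ z.re ∧ z.re ≤ 1) ∧ (-1 ≤ z.im ∧ z.im < 1) then
      (ultraspherical (-3 / 2) (k + 2) z.re : ℂ) / 3
        - (if k = 0 then (z.re : ℂ) else 0) + (if k = 1 then 1 / 3 else 0)
    else if z.re < -1 ∧ (-1 ≤ z.im ∧ z.im < 1) then
      -2 * (if k = 0 then (z.re : ℂ) else 0) + (if k = 1 then 2 / 3 else 0)
    else 0)

/-- `F^{(1)}(z)`. -/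
def F1 (z : ℂ) : Matrix ℕ ℕ ℂ :=
  Matrix.of fun k j =>
    if k = 0 then
      Complex.I * (M1 (j + 1) (z - 1) + M1 (j + 1) (z + 1)
          - prev (fun n => M1 n (z - 1)) j - prev (fun n => M1 n (z + 1)) j) / (2 * (j : ℂ) + 1)
        + mu j (z - 1) + mu j (z + 1)
    else if k = 1 ∧ j = 0 then -4 / 3
    else 0

/-- `F^{(2)}(z)`. -/
def F2 (z : ℂ) : Matrix ℕ ℕ ℂ :=
  Matrix.of fun k j =>
    if j = 0 then
      (L1 (k + 1) (z - Complex.I) + L1 (k + 1) (z + Complex.I)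
          - prev (fun n => L1 n (z - Complex.I)) k - prev (fun n => L1 n (z + Complex.I)) k)
          / (2 * (k : ℂ) + 1)
        + lam k (z - Complex.I) + lam k (z + Complex.I) + beta k 0 z
    else if k = 0 ∧ j = 1 then -(4 * Complex.I) / 3 + beta 0 1 z
    else beta k j z

def F (z : ℂ) : Matrix ℕ ℕ ℂ := F2 z - F1 z

end LogSquare

end

/-!
Since `C` maps a sequence `u` to `(u_{k+1} - u_{k-1}) / (2k + 1)`, it turns moments against the
Legendre polynomials into moments against their primitives. Hence the entries of `C L` and `L Cᵀ`
are double integrals of the logarithm against `Q_k(s) P_j(t)` and `P_k(s) Q_j(t)`, where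
`Q_k' = P_k`. Integrating by parts in `t` in the former and in `s` in the latter produces the same
integral of the Cauchy kernel `1 / (z - (s + it))`, up to the factor `i`, and it cancels in
`C L - i L Cᵀ`. What is left are the boundary terms on the four edges of the square and the jump of
the principal branch across its cut. As `Q_j(±1) = 0` for `j ≥ 1`, the two horizontal edges give a
matrix supported on column `0`, the two vertical edges one supported on row `0`, and the jump is an
outer product: three matrices of rank at most one.
-/

noncomputable section

namespace LogSquare

open MeasureTheory Complex Set Matrix

section Ultraspherical

variable (a x : ℝ) (n : ℕ)

theorem add_two_mul_ultraspherical :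
    (n + 2) * ultraspherical a (n + 2) x =
      2 * (n + 1 + a) * x * ultraspherical a (n + 1) x - (n + 2 * a) * ultraspherical a n x := by
  have : (n : ℝ) + 2 ≠ 0 := by positivity
  rw [ultraspherical]
  field_simp

theorem add_two_mul_ultraspherical_eq_raised : ∀ n : ℕ,
    (n + 2) * ultraspherical a (n + 2) x =
      2 * a * (x * ultraspherical (a + 1) (n + 1) x - ultraspherical (a + 1) n x)
  | 0 => by
    simp only [ultraspherical, Nat.cast_zero]
    ring
  | 1 => by
    simp only [ultraspherical, Nat.cast_zero, Nat.cast_one]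
    ring
  | n + 2 => by
    have ih₀ := add_two_mul_ultraspherical_eq_raised n
    have ih₁ := add_two_mul_ultraspherical_eq_raised (n + 1)
    have rec_a := add_two_mul_ultraspherical a x (n + 2)
    have rec₀ := add_two_mul_ultraspherical (a + 1) x n
    have rec₁ := add_two_mul_ultraspherical (a + 1) x (n + 1)
    have h₂ : (n : ℝ) + 2 ≠ 0 := by positivity
    have h₃ : (n : ℝ) + 3 ≠ 0 := by positivity
    push_cast at *
    refine mul_left_cancel₀ (mul_ne_zero h₂ h₃) ?_
    linear_combination (n + 2) * (n + 3) * rec_a + 2 * (n + 2) * (n + 3 + a) * x * ih₁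
      - (n + 3) * (n + 2 + 2 * a) * ih₀ - 2 * a * (n + 2) * x * rec₁ + 2 * a * (n + 3) * rec₀

theorem add_mul_ultraspherical_eq_sub_raised :
    (n + 2 + a) * ultraspherical a (n + 2) x =
      a * (ultraspherical (a + 1) (n + 2) x - ultraspherical (a + 1) n x) := by
  have : (n : ℝ) + 2 ≠ 0 := by positivity
  refine mul_left_cancel₀ this ?_
  linear_combination (n + 2 + a) * add_two_mul_ultraspherical_eq_raised a x n
    - a * add_two_mul_ultraspherical (a + 1) x n

theorem hasDerivAt_ultraspherical : ∀ n : ℕ,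
    HasDerivAt (ultraspherical a (n + 1)) (2 * a * ultraspherical (a + 1) n x) x
  | 0 => by
    have h := (hasDerivAt_id x).const_mul (2 * a)
    exact (h.congr_of_eventuallyEq (.of_forall fun y => rfl)).congr_deriv (by simp [ultraspherical])
  | 1 => by
    have h := (((hasDerivAt_pow 2 x).const_mul (4 * a * (1 + a))).sub_const (2 * a)).div_const 2
    refine (h.congr_of_eventuallyEq (.of_forall fun y => ?_)).congr_deriv ?_
    · simp only [ultraspherical, Nat.cast_zero]
      ring
    · simp only [ultraspherical, Nat.cast_ofNat, Nat.add_one_sub_one, pow_one]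
      ring
  | n + 2 => by
    have h₁ := hasDerivAt_ultraspherical (n + 1)
    have h₀ := hasDerivAt_ultraspherical n
    have h := ((((hasDerivAt_id x).const_mul (2 * (n + 2 + a))).mul h₁).sub
      (h₀.const_mul (n + 1 + 2 * a))).div_const (n + 3)
    refine (h.congr_of_eventuallyEq (.of_forall fun y => ?_)).congr_deriv ?_
    · simp only [ultraspherical, Nat.cast_add, Nat.cast_one, id_eq, Pi.sub_apply, Pi.mul_apply]
      ring
    · have : (n : ℝ) + 3 ≠ 0 := by positivity
      rw [div_eq_iff this]
      simp only [id]
      linear_combination (-2 * a) * add_two_mul_ultraspherical (a + 1) x n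
        + 2 * add_mul_ultraspherical_eq_sub_raised a x n

theorem continuous_ultraspherical : ∀ n : ℕ, Continuous (ultraspherical a n)
  | 0 => continuous_const
  | n + 1 => continuous_iff_continuousAt.2 fun x => (hasDerivAt_ultraspherical a x n).continuousAt

variable {a x}

theorem succ_mul_ultraspherical_of_sq_eq_one (hx : x ^ 2 = 1) : ∀ n : ℕ,
    (n + 1) * ultraspherical a (n + 1) x = (n + 2 * a) * x * ultraspherical a n x
  | 0 => by simp [ultraspherical]
  | n + 1 => by
    have ih := succ_mul_ultraspherical_of_sq_eq_one hx n
    push_cast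
    linear_combination add_two_mul_ultraspherical a x n + x * ih
      + (n + 2 * a) * ultraspherical a n x * hx

theorem ultraspherical_eq_zero_of_sq_eq_one {m n : ℕ} (ha : 2 * a = -m) (hx : x ^ 2 = 1)
    (hn : m < n) : ultraspherical a n x = 0 := by
  induction n, hn using Nat.le_induction with
  | base =>
    have h := succ_mul_ultraspherical_of_sq_eq_one (a := a) hx m
    have : (m : ℝ) + 1 ≠ 0 := by positivity
    simpa [ha, this] using h
  | succ n _ ih =>
    have h := succ_mul_ultraspherical_of_sq_eq_one (a := a) hx n
    have : (n : ℝ) + 1 ≠ 0 := by positivity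
    simpa [ih, this] using h

end Ultraspherical

theorem legendre_eq_ultraspherical (x : ℝ) : ∀ n, legendre n x = ultraspherical (1 / 2) n x
  | 0 => rfl
  | 1 => by simp [legendre, ultraspherical]
  | n + 2 => by
    rw [legendre, ultraspherical, legendre_eq_ultraspherical x (n + 1),
      legendre_eq_ultraspherical x n]
    ring

section LegendrePrimitive

@[fun_prop]
theorem continuous_legendre (n : ℕ) : Continuous (legendre n) :=
  (continuous_ultraspherical (1 / 2) n).congr fun x => (legendre_eq_ultraspherical x n).symm

/-- The primitive `(P_{k+1} - P_{k-1}) / (2k + 1)` of the Legendre polynomial `P_k`, with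
`P_{-1} = 0`, written as the ultraspherical polynomial through which it enters `mu` and `beta`.
For `k ≥ 1` it is the primitive that vanishes at `±1`; for `k = 0` it is `x`. -/
def legendrePrimitive (k : ℕ) (x : ℝ) : ℝ := -ultraspherical (-1 / 2) (k + 1) x

theorem hasDerivAt_legendrePrimitive (k : ℕ) (x : ℝ) :
    HasDerivAt (legendrePrimitive k) (legendre k x) x := by
  refine (hasDerivAt_ultraspherical (-1 / 2) x k).neg.congr_deriv ?_
  rw [legendre_eq_ultraspherical]
  norm_num

@[fun_prop]
theorem continuous_legendrePrimitive (k : ℕ) : Continuous (legendrePrimitive k) :=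
  (continuous_ultraspherical (-1 / 2) (k + 1)).neg

theorem legendrePrimitive_of_sq_eq_one {x : ℝ} (hx : x ^ 2 = 1) :
    ∀ k, legendrePrimitive k x = if k = 0 then x else 0
  | 0 => by norm_num [legendrePrimitive, ultraspherical]
  | k + 1 => by
    have h := ultraspherical_eq_zero_of_sq_eq_one (a := -1 / 2) (m := 1) (n := k + 1 + 1)
      (by norm_num) hx (by omega)
    simp [legendrePrimitive, h]

theorem hasDerivAt_ultraspherical_div_three (k : ℕ) (x : ℝ) :
    HasDerivAt (fun x => ultraspherical (-3 / 2) (k + 2) x / 3) (legendrePrimitive k x) x := by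
  refine ((hasDerivAt_ultraspherical (-3 / 2) x (k + 1)).div_const 3).congr_deriv ?_
  rw [legendrePrimitive, show (-3 / 2 + 1 : ℝ) = -1 / 2 by norm_num]
  ring

theorem ultraspherical_div_three_of_sq_eq_one {x : ℝ} (hx : x ^ 2 = 1) : ∀ k : ℕ,
    ultraspherical (-3 / 2) (k + 2) x / 3
      = (if k = 0 then 1 else 0) - if k = 1 then x / 3 else 0
  | 0 => by
    simp only [ultraspherical, Nat.cast_zero, if_true, zero_ne_one, if_false]
    linear_combination hx / 2
  | 1 => by
    simp only [ultraspherical, Nat.cast_zero, Nat.cast_one, one_ne_zero, if_true, if_false]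
    linear_combination x * hx / 6
  | k + 2 => by
    have h := ultraspherical_eq_zero_of_sq_eq_one (a := -3 / 2) (m := 3) (n := k + 2 + 2)
      (by norm_num) hx (by omega)
    simp [h]

/-- The operator `u ↦ (u_{k+1} - u_{k-1}) / (2k + 1)`, with `u_{-1} = 0`, which is multiplication
by the matrix `C`. It turns moments against the Legendre polynomials into moments against their
primitives `legendrePrimitive`. -/
def primitiveMoment (u : ℕ → ℂ) (k : ℕ) : ℂ := (u (k + 1) - prev u k) / (2 * k + 1)

theorem legendrePrimitive_eq_primitiveMoment (x : ℝ) : ∀ k,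
    (legendrePrimitive k x : ℂ) = primitiveMoment (fun n => (legendre n x : ℂ)) k
  | 0 => by norm_num [legendrePrimitive, ultraspherical, primitiveMoment, legendre, prev]
  | k + 1 => by
    have h := add_mul_ultraspherical_eq_sub_raised (-1 / 2) x k
    have ne : 2 * (k + 1 : ℝ) + 1 ≠ 0 := by positivity
    rw [show (-1 / 2 + 1 : ℝ) = 1 / 2 by norm_num] at h
    have key : legendrePrimitive (k + 1) x
        = (legendre (k + 2) x - legendre k x) / (2 * (k + 1) + 1) := by
      rw [legendrePrimitive, legendre_eq_ultraspherical, legendre_eq_ultraspherical, eq_div_iff ne]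
      linear_combination (-2) * h
    simp [key, primitiveMoment, prev]

theorem integral_mul_legendrePrimitive {α : Type*} [MeasurableSpace α] {μ : Measure α} {f : α → ℂ}
    {g : α → ℝ} (hf : ∀ n, Integrable (fun x => f x * legendre n (g x)) μ) (k : ℕ) :
    ∫ x, f x * legendrePrimitive k (g x) ∂μ
      = primitiveMoment (fun n => ∫ x, f x * legendre n (g x) ∂μ) k := by
  simp_rw [legendrePrimitive_eq_primitiveMoment]
  rcases k with _ | k
  · simp [primitiveMoment, prev]
  · simp_rw [primitiveMoment, prev, mul_div_assoc', mul_sub]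
    rw [integral_div, integral_sub (hf _) (hf _)]

end LegendrePrimitive

section Integrability

theorem norm_log_le {w : ℂ} {ρ : ℝ} (hρ : 0 < ρ) (h : ρ ≤ ‖w‖) :
    ‖log w‖ ≤ Real.pi + ‖w‖ + |Real.log ρ| := by
  have hw : 0 < ‖w‖ := hρ.trans_le h
  have norm_le : ‖log w‖ ≤ |Real.log ‖w‖| + |arg w| := by
    simpa only [log_re, log_im] using norm_le_abs_re_add_abs_im (log w)
  have upper : Real.log ‖w‖ ≤ ‖w‖ := Real.log_le_self hw.le
  have lower : -|Real.log ρ| ≤ Real.log ‖w‖ :=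
    (neg_abs_le _).trans (Real.log_le_log hρ h)
  have abs_log_le : |Real.log ‖w‖| ≤ ‖w‖ + |Real.log ρ| :=
    abs_le.2 ⟨by linarith, by linarith [abs_nonneg (Real.log ρ)]⟩
  linarith [abs_arg_le_pi w]

theorem norm_inv_le {w : ℂ} (hre : w.re ≠ 0) (him : w.im ≠ 0) :
    ‖w⁻¹‖ ≤ |w.re| ^ (-(1 / 2) : ℝ) * |w.im| ^ (-(1 / 2) : ℝ) := by
  have hr := abs_pos.2 hre
  have hi := abs_pos.2 him
  have hw : 0 < ‖w‖ := hr.trans_le (abs_re_le_norm w)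
  calc ‖w⁻¹‖ = ‖w‖ ^ (-(1 / 2) : ℝ) * ‖w‖ ^ (-(1 / 2) : ℝ) := by
        rw [norm_inv, ← Real.rpow_add hw, ← Real.rpow_neg_one]
        norm_num
    _ ≤ |w.re| ^ (-(1 / 2) : ℝ) * |w.im| ^ (-(1 / 2) : ℝ) := by
        gcongr ?_ * ?_
        · exact Real.rpow_le_rpow_of_nonpos hr (abs_re_le_norm w) (by norm_num)
        · exact Real.rpow_le_rpow_of_nonpos hi (abs_im_le_norm w) (by norm_num)

theorem intervalIntegrable_abs_rpow {r : ℝ} (hr : -1 < r) (a b : ℝ) :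
    IntervalIntegrable (fun s : ℝ => |s| ^ r) volume a b := by
  refine intervalIntegrable_of_even (fun s => by rw [abs_neg]) fun x hx => ?_
  refine (intervalIntegral.intervalIntegrable_rpow' hr).congr fun s hs => ?_
  rw [uIoc_of_le hx.le] at hs
  simp only [abs_of_pos hs.1]

theorem intervalIntegrable_abs_sub_rpow {r : ℝ} (hr : -1 < r) (x a b : ℝ) :
    IntervalIntegrable (fun s : ℝ => |x - s| ^ r) volume a b := by
  simpa using (intervalIntegrable_abs_rpow hr (x - a) (x - b)).comp_sub_left x

theorem intervalIntegrable_abs_log_sub (x a b : ℝ) :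
    IntervalIntegrable (fun s : ℝ => |Real.log (x - s)|) volume a b := by
  have := (intervalIntegral.intervalIntegrable_log' (a := x - a) (b := x - b)).comp_sub_left x
  simpa using this.norm

theorem ae_sub_ne_zero (x : ℝ) : ∀ᵐ s : ℝ, x - s ≠ 0 := by
  filter_upwards [Measure.ae_ne volume x] with s hs
  exact sub_ne_zero.2 hs.symm

theorem intervalIntegrable_log_comp {w : ℝ → ℂ} (hw : Continuous w) {x : ℝ}
    (h : ∀ s, |x - s| ≤ ‖w s‖) (a b : ℝ) :
    IntervalIntegrable (fun s => log (w s)) volume a b := by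
  have bound : IntervalIntegrable (fun s => Real.pi + ‖w s‖ + |Real.log (x - s)|) volume a b :=
    ((continuous_const.add hw.norm).intervalIntegrable a b).add
      (intervalIntegrable_abs_log_sub x a b)
  refine bound.mono_fun (measurable_log.comp hw.measurable).aestronglyMeasurable ?_
  filter_upwards [ae_restrict_of_ae (ae_sub_ne_zero x)] with s hs
  rw [← Real.log_abs (x - s)]
  exact (norm_log_le (abs_pos.2 hs) (h s)).trans (le_abs_self _)

variable (z : ℂ) (a b c d : ℝ)

theorem intervalIntegrable_log_sub_ofReal :
    IntervalIntegrable (fun s : ℝ => log (z - s)) volume a b :=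
  intervalIntegrable_log_comp (by fun_prop) (x := z.re)
    (fun s => by simpa using abs_re_le_norm (z - s)) a b

theorem intervalIntegrable_log_sub_I_mul :
    IntervalIntegrable (fun t : ℝ => log (z - I * t)) volume a b :=
  intervalIntegrable_log_comp (by fun_prop) (x := z.im)
    (fun t => by simpa using abs_im_le_norm (z - I * t)) a b

variable {a b c d}

theorem integrableOn_rect_mul {f g : ℝ → ℝ} (hab : a ≤ b) (hcd : c ≤ d)
    (hf : IntervalIntegrable f volume a b) (hg : IntervalIntegrable g volume c d) :
    IntegrableOn (fun p : ℝ × ℝ => f p.1 * g p.2) (Icc a b ×ˢ Icc c d) := by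
  rw [intervalIntegrable_iff_integrableOn_Icc_of_le hab] at hf
  rw [intervalIntegrable_iff_integrableOn_Icc_of_le hcd] at hg
  rw [IntegrableOn, Measure.volume_eq_prod, ← Measure.prod_restrict]
  exact hf.mul_prod hg

theorem integrableOn_rect_log (hab : a ≤ b) (hcd : c ≤ d) :
    IntegrableOn (fun p : ℝ × ℝ => log (z - (p.1 + I * p.2))) (Icc a b ×ˢ Icc c d) := by
  have cont : Continuous fun p : ℝ × ℝ => z - (p.1 + I * p.2) := by fun_prop
  have bound : IntegrableOn (fun p : ℝ × ℝ =>
      Real.pi + ‖z - (p.1 + I * p.2)‖ + |Real.log (z.re - p.1)| * 1) (Icc a b ×ˢ Icc c d) :=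
    Integrable.add ((continuous_const.add cont.norm).continuousOn.integrableOn_compact
      (isCompact_Icc.prod isCompact_Icc)) (integrableOn_rect_mul hab hcd
        (intervalIntegrable_abs_log_sub z.re a b) intervalIntegrable_const)
  refine Integrable.mono bound (measurable_log.comp cont.measurable).aestronglyMeasurable ?_
  filter_upwards [ae_restrict_of_ae (Measure.quasiMeasurePreserving_fst.ae
    (ae_sub_ne_zero z.re))] with p hp
  have le_norm : |z.re - p.1| ≤ ‖z - (p.1 + I * p.2)‖ := by
    simpa using abs_re_le_norm (z - (p.1 + I * p.2))
  rw [mul_one, ← Real.log_abs (z.re - p.1)]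
  exact (norm_log_le (abs_pos.2 hp) le_norm).trans (le_abs_self _)

theorem integrableOn_rect_inv (hab : a ≤ b) (hcd : c ≤ d) :
    IntegrableOn (fun p : ℝ × ℝ => (z - (p.1 + I * p.2))⁻¹) (Icc a b ×ˢ Icc c d) := by
  have cont : Continuous fun p : ℝ × ℝ => z - (p.1 + I * p.2) := by fun_prop
  have bound := integrableOn_rect_mul hab hcd
    (intervalIntegrable_abs_sub_rpow (r := -(1 / 2)) (by norm_num) z.re a b)
    (intervalIntegrable_abs_sub_rpow (r := -(1 / 2)) (by norm_num) z.im c d)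
  refine Integrable.mono bound cont.measurable.inv.aestronglyMeasurable ?_
  filter_upwards [ae_restrict_of_ae (Measure.quasiMeasurePreserving_fst.ae (ae_sub_ne_zero z.re)),
    ae_restrict_of_ae (Measure.quasiMeasurePreserving_snd.ae (ae_sub_ne_zero z.im))] with p hs ht
  have h := norm_inv_le (w := z - (p.1 + I * p.2)) (by simpa using hs) (by simpa using ht)
  simpa using h.trans (le_abs_self _)

theorem integrableOn_rect_mul_continuous {h : ℝ × ℝ → ℂ}
    (hh : IntegrableOn h (Icc a b ×ˢ Icc c d)) {f g : ℝ → ℂ} (hf : Continuous f)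
    (hg : Continuous g) :
    IntegrableOn (fun p => h p * (f p.1 * g p.2)) (Icc a b ×ˢ Icc c d) :=
  hh.mul_continuousOn (by fun_prop) (isCompact_Icc.prod isCompact_Icc)

end Integrability

section Fubini

variable {E : Type*} [NormedAddCommGroup E] [NormedSpace ℝ E] {a b c d : ℝ} {f : ℝ × ℝ → E}

theorem integral_rect (hab : a ≤ b) (hcd : c ≤ d) (hf : IntegrableOn f (Icc a b ×ˢ Icc c d)) :
    ∫ p in Icc a b ×ˢ Icc c d, f p = ∫ s in a..b, ∫ t in c..d, f (s, t) := by
  simp_rw [intervalIntegral.integral_of_le hab, intervalIntegral.integral_of_le hcd,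
    ← integral_Icc_eq_integral_Ioc]
  exact setIntegral_prod f hf

theorem integral_rect_symm (hab : a ≤ b) (hcd : c ≤ d)
    (hf : IntegrableOn f (Icc a b ×ˢ Icc c d)) :
    ∫ p in Icc a b ×ˢ Icc c d, f p = ∫ t in c..d, ∫ s in a..b, f (s, t) := by
  simp_rw [intervalIntegral.integral_of_le hab, intervalIntegral.integral_of_le hcd,
    ← integral_Icc_eq_integral_Ioc]
  rw [IntegrableOn, Measure.volume_eq_prod, ← Measure.prod_restrict] at hf
  rw [Measure.volume_eq_prod, ← Measure.prod_restrict]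
  exact integral_prod_symm f hf

theorem intervalIntegrable_integral_snd (hab : a ≤ b) (hcd : c ≤ d)
    (hf : IntegrableOn f (Icc a b ×ˢ Icc c d)) :
    IntervalIntegrable (fun s => ∫ t in c..d, f (s, t)) volume a b := by
  simp_rw [intervalIntegral.integral_of_le hcd, ← integral_Icc_eq_integral_Ioc]
  rw [intervalIntegrable_iff_integrableOn_Icc_of_le hab]
  rw [IntegrableOn, Measure.volume_eq_prod, ← Measure.prod_restrict] at hf
  exact hf.integral_prod_left

theorem intervalIntegrable_integral_fst (hab : a ≤ b) (hcd : c ≤ d)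
    (hf : IntegrableOn f (Icc a b ×ˢ Icc c d)) :
    IntervalIntegrable (fun t => ∫ s in a..b, f (s, t)) volume c d := by
  simp_rw [intervalIntegral.integral_of_le hab, ← integral_Icc_eq_integral_Ioc]
  rw [intervalIntegrable_iff_integrableOn_Icc_of_le hcd]
  rw [IntegrableOn, Measure.volume_eq_prod, ← Measure.prod_restrict] at hf
  exact hf.integral_prod_right

end Fubini

section IntegrationByParts

theorem integral_indicator_Ioi_deriv {E : Type*} [NormedAddCommGroup E] [NormedSpace ℝ E]
    [CompleteSpace E] {g g' : ℝ → E} {a b : ℝ} (hab : a ≤ b) (hg : ∀ t, HasDerivAt g (g' t) t)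
    (hg' : Continuous g') (y : ℝ) :
    ∫ t in a..b, (Ioi y).indicator g' t
      = (if y < b then g b else 0) - (if y < a then g a else 0)
        - if a ≤ y ∧ y < b then g y else 0 := by
  have ftc (u v : ℝ) : ∫ t in u..v, g' t = g v - g u :=
    intervalIntegral.integral_eq_sub_of_hasDerivAt (fun t _ => hg t) (hg'.intervalIntegrable _ _)
  rw [intervalIntegral.integral_of_le hab, setIntegral_indicator measurableSet_Ioi, Ioc_inter_Ioi]
  rcases lt_or_ge y a with ya | ay
  · have not_mem : ¬(a ≤ y ∧ y < b) := fun h => h.1.not_gt ya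
    rw [max_eq_left ya.le, ← intervalIntegral.integral_of_le hab, ftc, if_pos (ya.trans_le hab),
      if_pos ya, if_neg not_mem, sub_zero]
  · rw [max_eq_right ay, if_neg ay.not_gt, sub_zero]
    rcases lt_or_ge y b with yb | hby
    · rw [← intervalIntegral.integral_of_le yb.le, ftc, if_pos yb, if_pos ⟨ay, yb⟩]
    · rw [Ioc_eq_empty hby.not_gt, setIntegral_empty, if_neg hby.not_gt,
        if_neg fun h => hby.not_gt h.2, sub_zero]

theorem intervalIntegrable_indicator {E : Type*} [NormedAddCommGroup E] {g : ℝ → E} {s : Set ℝ}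
    {a b : ℝ} (hg : IntervalIntegrable g volume a b) (hs : MeasurableSet s) :
    IntervalIntegrable (s.indicator g) volume a b := by
  rw [intervalIntegrable_iff] at hg ⊢
  exact hg.indicator hs

theorem log_eq_log_neg_of_re_neg {w : ℂ} (hw : w.re < 0) :
    log w = log (-w) + Real.pi * I - if w.im < 0 then 2 * Real.pi * I else 0 := by
  have arg_neg : arg (-w) = Real.arcsin ((-w).im / ‖w‖) := by
    rw [arg_of_re_nonneg (by simpa using hw.le), norm_neg]
  rw [log, log, norm_neg, arg_neg]
  split_ifs with him
  · rw [arg_of_re_neg_of_im_neg hw him]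
    push_cast
    ring
  · rw [arg_of_re_neg_of_im_nonneg hw (not_lt.1 him)]
    push_cast
    ring

variable {w w' f f' g g' : ℝ → ℂ} {a b c d : ℝ}

theorem integral_log_comp_mul_deriv (hw : ∀ t, HasDerivAt w (w' t) t) (hw' : Continuous w')
    (mem : ∀ t, w t ∈ slitPlane) (hg : ∀ t, HasDerivAt g (g' t) t) (hg' : Continuous g') :
    ∫ t in a..b, log (w t) * g' t
      = log (w b) * g b - log (w a) * g a - ∫ t in a..b, w' t / w t * g t := by
  have cont : Continuous w := continuous_iff_continuousAt.2 fun t => (hw t).continuousAt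
  exact intervalIntegral.integral_mul_deriv_eq_deriv_mul (fun t _ => (hw t).clog_real (mem t))
    (fun t _ => hg t)
    ((hw'.div cont fun t => slitPlane_ne_zero (mem t)).intervalIntegrable _ _)
    (hg'.intervalIntegrable _ _)

theorem integral_log_sub_const_mul_mul_deriv {z w : ℂ} (mem : ∀ t : ℝ, z - w * t ∈ slitPlane)
    (hg : ∀ t, HasDerivAt g (g' t) t) (hg' : Continuous g') :
    ∫ t in a..b, log (z - w * t) * g' t
      = log (z - w * b) * g b - log (z - w * a) * g a + w * ∫ t in a..b, (z - w * t)⁻¹ * g t := by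
  have hw (t : ℝ) : HasDerivAt (fun t : ℝ => z - w * t) (-w) t :=
    (((hasDerivAt_id t).ofReal_comp.const_mul w).const_sub z).congr_deriv (by simp)
  rw [integral_log_comp_mul_deriv hw continuous_const mem hg hg',
    ← intervalIntegral.integral_const_mul, sub_eq_add_neg _ (∫ t in a..b, _),
    ← intervalIntegral.integral_neg]
  simp only [div_eq_mul_inv, neg_mul, neg_neg, mul_assoc]

theorem integral_log_sub_I_mul_mul_deriv_of_re_neg (hab : a ≤ b) {z : ℂ} (hz : z.re < 0)
    (hg : ∀ t, HasDerivAt g (g' t) t) (hg' : Continuous g') :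
    ∫ t in a..b, log (z - I * t) * g' t
      = log (z - I * b) * g b - log (z - I * a) * g a + I * (∫ t in a..b, (z - I * t)⁻¹ * g t)
        + 2 * Real.pi * I * if a ≤ z.im ∧ z.im < b then g z.im else 0 := by
  have mem (t : ℝ) : -z - -I * t ∈ slitPlane := .inl (by simpa using hz)
  -- Unlike `log (z - it)`, the branch `log (it - z)` is smooth on the whole line.
  have log_eq (t : ℝ) : log (z - I * t)
      = log (-z - -I * t) + Real.pi * I - if z.im < t then 2 * Real.pi * I else 0 := by
    rw [log_eq_log_neg_of_re_neg (w := z - I * t) (by simpa using hz)]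
    simp [neg_add_eq_sub, sub_eq_add_neg]
  have split (t : ℝ) : log (z - I * t) * g' t = log (-z - -I * t) * g' t + Real.pi * I * g' t
      - 2 * Real.pi * I * (Ioi z.im).indicator g' t := by
    rw [log_eq, indicator_apply]
    simp only [mem_Ioi]
    split_ifs <;> ring
  have int_log : IntervalIntegrable (fun t : ℝ => log (-z - -I * t) * g' t) volume a b :=
    ((Continuous.clog (by fun_prop) mem).mul hg').intervalIntegrable _ _
  have int_g' : IntervalIntegrable g' volume a b := hg'.intervalIntegrable _ _
  have int_jump := intervalIntegrable_indicator int_g' (measurableSet_Ioi (a := z.im))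
  have inv_neg (t : ℝ) : (-z - -I * t)⁻¹ * g t = -((z - I * t)⁻¹ * g t) := by
    rw [show -z - -I * t = -(z - I * t) by ring, _root_.inv_neg, neg_mul]
  simp_rw [split]
  rw [intervalIntegral.integral_sub (int_log.add (int_g'.const_mul _)) (int_jump.const_mul _),
    intervalIntegral.integral_add int_log (int_g'.const_mul _),
    intervalIntegral.integral_const_mul, intervalIntegral.integral_const_mul,
    integral_log_sub_const_mul_mul_deriv mem hg hg',
    intervalIntegral.integral_eq_sub_of_hasDerivAt (fun t _ => hg t) int_g',
    integral_indicator_Ioi_deriv hab hg hg', log_eq a, log_eq b]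
  simp_rw [inv_neg, intervalIntegral.integral_neg]
  split_ifs <;> ring

theorem integral_log_sub_I_mul_mul_deriv (hab : a ≤ b) {z : ℂ} (hz : z.re ≠ 0)
    (hg : ∀ t, HasDerivAt g (g' t) t) (hg' : Continuous g') :
    ∫ t in a..b, log (z - I * t) * g' t
      = log (z - I * b) * g b - log (z - I * a) * g a + I * (∫ t in a..b, (z - I * t)⁻¹ * g t)
        + 2 * Real.pi * I * if z.re < 0 ∧ a ≤ z.im ∧ z.im < b then g z.im else 0 := by
  rcases hz.lt_or_gt with hneg | hpos
  · simp only [hneg, true_and, integral_log_sub_I_mul_mul_deriv_of_re_neg hab hneg hg hg']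
  · simp [hpos.not_gt,
      integral_log_sub_const_mul_mul_deriv (z := z) (w := I)
        (fun t => .inl (by simpa using hpos)) hg hg']

theorem integral_rect_log_mul_deriv_fst (hab : a ≤ b) (hcd : c ≤ d) (z : ℂ)
    (hf : ∀ s, HasDerivAt f (f' s) s) (hf' : Continuous f') (hg : Continuous g) :
    ∫ p in Icc a b ×ˢ Icc c d, log (z - (p.1 + I * p.2)) * (f' p.1 * g p.2)
      = f b * (∫ t in c..d, log (z - b - I * t) * g t)
        - f a * (∫ t in c..d, log (z - a - I * t) * g t)
        + ∫ p in Icc a b ×ˢ Icc c d, (z - (p.1 + I * p.2))⁻¹ * (f p.1 * g p.2) := by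
  have hf_cont : Continuous f := continuous_iff_continuousAt.2 fun s => (hf s).continuousAt
  have int_log := integrableOn_rect_mul_continuous (integrableOn_rect_log z hab hcd) hf' hg
  have int_inv := integrableOn_rect_mul_continuous (integrableOn_rect_inv z hab hcd) hf_cont hg
  have int_edge (x : ℝ) : IntervalIntegrable (fun t : ℝ => log (z - x - I * t) * g t) volume c d :=
    (intervalIntegrable_log_sub_I_mul _ _ _).mul_continuousOn hg.continuousOn
  have inner : ∀ᵐ t : ℝ, t ∈ uIoc c d →
      ∫ s in a..b, log (z - (s + I * t)) * (f' s * g t)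
        = f b * (log (z - b - I * t) * g t) - f a * (log (z - a - I * t) * g t)
          + ∫ s in a..b, (z - (s + I * t))⁻¹ * (f s * g t) := by
    filter_upwards [ae_sub_ne_zero z.im] with t ht _
    have mem (s : ℝ) : z - I * t - 1 * s ∈ slitPlane := .inr (by simpa using ht)
    have parts := integral_log_sub_const_mul_mul_deriv (a := a) (b := b) mem hf hf'
    have comm (s : ℝ) : z - I * t - 1 * s = z - (s + I * t) := by ring
    simp_rw [comm] at parts
    simp_rw [← mul_assoc, intervalIntegral.integral_mul_const, parts, sub_sub]
    ring
  rw [integral_rect_symm hab hcd int_log, integral_rect_symm hab hcd int_inv,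
    intervalIntegral.integral_congr_ae inner,
    intervalIntegral.integral_add (((int_edge b).const_mul _).sub ((int_edge a).const_mul _))
      (intervalIntegrable_integral_fst hab hcd int_inv),
    intervalIntegral.integral_sub ((int_edge b).const_mul _) ((int_edge a).const_mul _),
    intervalIntegral.integral_const_mul, intervalIntegral.integral_const_mul]

theorem integral_rect_log_mul_deriv_snd (hab : a ≤ b) (hcd : c ≤ d) (z : ℂ) (hf : Continuous f)
    (hg : ∀ t, HasDerivAt g (g' t) t) (hg' : Continuous g') :
    ∫ p in Icc a b ×ˢ Icc c d, log (z - (p.1 + I * p.2)) * (f p.1 * g' p.2)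
      = g d * (∫ s in a..b, log (z - I * d - s) * f s)
        - g c * (∫ s in a..b, log (z - I * c - s) * f s)
        + I * (∫ p in Icc a b ×ˢ Icc c d, (z - (p.1 + I * p.2))⁻¹ * (f p.1 * g p.2))
        + 2 * Real.pi * I * (if c ≤ z.im ∧ z.im < d then g z.im else 0)
          * ∫ s in a..b, (Ioi z.re).indicator f s := by
  have hg_cont : Continuous g := continuous_iff_continuousAt.2 fun t => (hg t).continuousAt
  have int_log := integrableOn_rect_mul_continuous (integrableOn_rect_log z hab hcd) hf hg'
  have int_inv := integrableOn_rect_mul_continuous (integrableOn_rect_inv z hab hcd) hf hg_cont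
  have int_edge (y : ℝ) : IntervalIntegrable (fun s : ℝ => log (z - I * y - s) * f s) volume a b :=
    (intervalIntegrable_log_sub_ofReal _ _ _).mul_continuousOn hf.continuousOn
  have int_jump := intervalIntegrable_indicator
    (hf.intervalIntegrable (μ := volume) a b) (measurableSet_Ioi (a := z.re))
  set jump : ℂ := if c ≤ z.im ∧ z.im < d then g z.im else 0 with jump_def
  have inner : ∀ᵐ s : ℝ, s ∈ uIoc a b →
      ∫ t in c..d, log (z - (s + I * t)) * (f s * g' t)
        = g d * (log (z - I * d - s) * f s) - g c * (log (z - I * c - s) * f s)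
          + I * (∫ t in c..d, (z - (s + I * t))⁻¹ * (f s * g t))
          + 2 * Real.pi * I * jump * (Ioi z.re).indicator f s := by
    filter_upwards [ae_sub_ne_zero z.re] with s hs _
    have parts := integral_log_sub_I_mul_mul_deriv hcd (z := z - s) (by simpa using hs) hg hg'
    simp_rw [sub_sub] at parts
    simp_rw [mul_left_comm _ (f s), intervalIntegral.integral_const_mul, parts, sub_sub,
      indicator_apply]
    have re_neg : (z - s).re < 0 ↔ z.re < s := by simp
    simp only [re_neg, sub_im, ofReal_im, sub_zero, ite_and, jump_def, mem_Ioi, add_comm]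
    split_ifs <;> ring
  rw [integral_rect hab hcd int_log, integral_rect hab hcd int_inv,
    intervalIntegral.integral_congr_ae inner,
    intervalIntegral.integral_add ((((int_edge d).const_mul _).sub ((int_edge c).const_mul _)).add
      ((intervalIntegrable_integral_snd hab hcd int_inv).const_mul _)) (int_jump.const_mul _),
    intervalIntegral.integral_add (((int_edge d).const_mul _).sub ((int_edge c).const_mul _))
      ((intervalIntegrable_integral_snd hab hcd int_inv).const_mul _),
    intervalIntegral.integral_sub ((int_edge d).const_mul _) ((int_edge c).const_mul _)]
  simp_rw [intervalIntegral.integral_const_mul]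

end IntegrationByParts

section Sylvester

theorem integrableOn_logIntegrand (k j : ℕ) (z : ℂ) :
    IntegrableOn (logIntegrand k j z) square :=
  integrableOn_rect_mul_continuous (f := fun s => (legendre k s : ℂ))
    (g := fun t => (legendre j t : ℂ)) (integrableOn_rect_log z (by norm_num) (by norm_num))
    (by fun_prop) (by fun_prop)

theorem integral_log_sub_ofReal_mul_legendrePrimitive (z : ℂ) (k : ℕ) :
    ∫ s in (-1 : ℝ)..1, log (z - s) * legendrePrimitive k s = primitiveMoment (L1 · z) k := by
  simp only [L1, intervalIntegral.integral_of_le (show (-1 : ℝ) ≤ 1 by norm_num)]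
  refine integral_mul_legendrePrimitive (g := id) (fun n => ?_) k
  exact ((intervalIntegrable_log_sub_ofReal z _ _).mul_continuousOn
    (g := fun x => (legendre n x : ℂ)) (by fun_prop)).1

theorem integral_log_sub_I_mul_mul_legendrePrimitive (z : ℂ) (j : ℕ) :
    ∫ t in (-1 : ℝ)..1, log (z - I * t) * legendrePrimitive j t = primitiveMoment (M1 · z) j := by
  simp only [M1, intervalIntegral.integral_of_le (show (-1 : ℝ) ≤ 1 by norm_num)]
  refine integral_mul_legendrePrimitive (g := id) (fun n => ?_) j
  exact ((intervalIntegrable_log_sub_I_mul z _ _).mul_continuousOn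
    (g := fun x => (legendre n x : ℂ)) (by fun_prop)).1

theorem primitiveMoment_L_left (z : ℂ) (k j : ℕ) :
    primitiveMoment (fun n => L z n j) k
      = ∫ p in square, log (z - (p.1 + I * p.2)) * (legendrePrimitive k p.1 * legendre j p.2) := by
  have comm (n : ℕ) (p : ℝ × ℝ) :
      logIntegrand n j z p = log (z - (p.1 + I * p.2)) * legendre j p.2 * legendre n p.1 := by
    rw [logIntegrand]
    ring
  have int (n : ℕ) := (integrableOn_logIntegrand n j z).congr (.of_forall (comm n))
  simp only [L, of_apply, comm]
  rw [← integral_mul_legendrePrimitive int]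
  congr! 2
  ring

theorem primitiveMoment_L_right (z : ℂ) (k j : ℕ) :
    primitiveMoment (fun n => L z k n) j
      = ∫ p in square, log (z - (p.1 + I * p.2)) * (legendre k p.1 * legendrePrimitive j p.2) := by
  have comm (n : ℕ) (p : ℝ × ℝ) :
      logIntegrand k n z p = log (z - (p.1 + I * p.2)) * legendre k p.1 * legendre n p.2 := by
    rw [logIntegrand]
    ring
  have int (n : ℕ) := (integrableOn_logIntegrand k n z).congr (.of_forall (comm n))
  simp only [L, of_apply, comm]
  rw [← integral_mul_legendrePrimitive int]
  congr! 2
  ring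

/-- The contribution to the Sylvester equation of the edges `t = ±1` of the square. -/
def horizontalEdges (z : ℂ) (k : ℕ) : ℂ :=
  primitiveMoment (L1 · (z - I)) k + primitiveMoment (L1 · (z + I)) k

/-- The contribution to the Sylvester equation of the edges `s = ±1` of the square. -/
def verticalEdges (z : ℂ) (j : ℕ) : ℂ :=
  primitiveMoment (M1 · (z - 1)) j + primitiveMoment (M1 · (z + 1)) j

/-- The part of the jump across the branch cut that depends on the row. The singularity `s + it`
of `w ↦ log (w - (s + it))` has `z` on its cut if `t = Im z` and `s > Re z`. -/
def cutRow (z : ℂ) (k : ℕ) : ℂ :=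
  2 * Real.pi * I *
    ∫ s in (-1 : ℝ)..1, (Ioi z.re).indicator (fun s => (legendrePrimitive k s : ℂ)) s

/-- The part of the jump across the branch cut that depends on the column. The bottom edge belongs
to the cut and the top edge does not, because the principal branch has `arg ∈ (-π, π]`. -/
def cutCol (z : ℂ) (j : ℕ) : ℂ :=
  if -1 ≤ z.im ∧ z.im < 1 then legendrePrimitive j z.im else 0

theorem primitiveMoment_L_left_eq (z : ℂ) (k j : ℕ) :
    primitiveMoment (fun n => L z n j) k
      = horizontalEdges z k * Pi.single (M := fun _ => ℂ) 0 1 j + cutRow z k * cutCol z j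
        + I * ∫ p in square,
            (z - (p.1 + I * p.2))⁻¹ * (legendrePrimitive k p.1 * legendrePrimitive j p.2) := by
  rw [primitiveMoment_L_left, square,
    integral_rect_log_mul_deriv_snd (by norm_num) (by norm_num) z
    (f := fun s => (legendrePrimitive k s : ℂ)) (by fun_prop)
    (fun t => (hasDerivAt_legendrePrimitive j t).ofReal_comp) (by fun_prop)]
  simp only [horizontalEdges, cutRow, cutCol,
    ← integral_log_sub_ofReal_mul_legendrePrimitive, legendrePrimitive_of_sq_eq_one (x := 1),
    legendrePrimitive_of_sq_eq_one (x := -1), one_pow, neg_one_sq, Pi.single_apply, ofReal_one,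
    ofReal_neg, mul_one, mul_neg, sub_neg_eq_add]
  split_ifs <;> push_cast <;> ring

theorem primitiveMoment_L_right_eq (z : ℂ) (k j : ℕ) :
    primitiveMoment (fun n => L z k n) j
      = Pi.single (M := fun _ => ℂ) 0 1 k * verticalEdges z j
        + ∫ p in square,
            (z - (p.1 + I * p.2))⁻¹ * (legendrePrimitive k p.1 * legendrePrimitive j p.2) := by
  rw [primitiveMoment_L_right, square,
    integral_rect_log_mul_deriv_fst (by norm_num) (by norm_num) z
    (fun s => (hasDerivAt_legendrePrimitive k s).ofReal_comp)
    (g := fun t => (legendrePrimitive j t : ℂ)) (by fun_prop) (by fun_prop)]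
  simp only [verticalEdges, ← integral_log_sub_I_mul_mul_legendrePrimitive,
    legendrePrimitive_of_sq_eq_one (x := 1), legendrePrimitive_of_sq_eq_one (x := -1), one_pow,
    neg_one_sq, Pi.single_apply, ofReal_one, ofReal_neg, sub_neg_eq_add]
  split_ifs <;> push_cast <;> ring

theorem C_apply (k n : ℕ) : C k n =
    if k = n + 1 then -1 / (2 * (k : ℂ) + 1)
    else if n = k + 1 then 1 / (2 * (k : ℂ) + 1)
    else 0 := by
  simp only [C, A, B, Matrix.sub_apply, of_apply]
  split_ifs <;> ring

theorem tsum_C_mul (u : ℕ → ℂ) : ∀ k, ∑' n, C k n * u n = primitiveMoment u k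
  | 0 => by
    rw [tsum_eq_single 1 fun n hn => by simp [C_apply, hn]]
    simp [C_apply, primitiveMoment, prev]
  | k + 1 => by
    rw [tsum_eq_sum (s := {k, k + 2}) fun n hn => ?_, Finset.sum_pair (by omega)]
    · simp only [C_apply, primitiveMoment, prev, Nat.cast_add, Nat.cast_one, if_true,
        show k + 1 ≠ k + 2 + 1 by omega, if_false]
      ring
    · simp only [Finset.mem_insert, Finset.mem_singleton, not_or] at hn
      rw [C_apply, if_neg (by omega), if_neg (by omega), zero_mul]

theorem infMul_C_apply (X : Matrix ℕ ℕ ℂ) (k j : ℕ) :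
    infMul C X k j = primitiveMoment (fun n => X n j) k :=
  tsum_C_mul (fun n => X n j) k

theorem infMul_C_transpose_apply (X : Matrix ℕ ℕ ℂ) (k j : ℕ) :
    infMul X Cᵀ k j = primitiveMoment (fun n => X k n) j := by
  simp only [infMul, of_apply, transpose_apply, mul_comm (X k _), tsum_C_mul]

theorem infMul_C_L_sub (z : ℂ) :
    infMul C (L z) - I • infMul (L z) Cᵀ
      = vecMulVec (horizontalEdges z) (Pi.single 0 1)
        + vecMulVec (Pi.single 0 1) (-I • verticalEdges z) + vecMulVec (cutRow z) (cutCol z) := by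
  ext k j
  simp only [Matrix.add_apply, Matrix.sub_apply, Matrix.smul_apply, infMul_C_apply,
    infMul_C_transpose_apply, primitiveMoment_L_left_eq, primitiveMoment_L_right_eq,
    vecMulVec_apply, Pi.smul_apply, smul_eq_mul]
  ring

end Sylvester

section RightHandSide

theorem mul_logMinus (w : ℂ) :
    w * logMinus w = w * log w - if w.im = 0 ∧ w.re < 0 then 2 * Real.pi * I * w.re else 0 := by
  rw [logMinus]
  split_ifs with h
  · have w_eq_re : w = (w.re : ℂ) := Complex.ext rfl (by simpa using h.1)
    have arg_eq_pi : arg w = Real.pi := arg_eq_pi_iff.2 h.symm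
    rw [log, arg_eq_pi, ← w_eq_re]
    ring
  · rw [sub_zero]

theorem mu_eq (j : ℕ) (z : ℂ) :
    mu j z = (if j = 0 then (z - I) * log (z - I) + (z + I) * log (z + I) else 0)
      - (if j = 1 then 2 * I / 3 else 0)
      + 2 * Real.pi * I * (min z.re 0 : ℝ) * cutCol z j := by
  have im_add_I : (z + I).im = 0 ↔ z.im = -1 := by simp [add_eq_zero_iff_eq_neg]
  have re_add_I : (z + I).re = z.re := by simp
  rw [mu, mul_logMinus, cutCol]
  simp only [im_add_I, re_add_I]
  -- The jump comes from `logMinus` if `y = -1`, and from the last term of `mu` otherwise.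
  rcases eq_or_ne z.im (-1) with him | him
  · rw [him, legendrePrimitive_of_sq_eq_one (by norm_num)]
    rcases lt_or_ge z.re 0 with left | right
    · rw [min_eq_left left.le]
      rcases j with _ | _ | j <;> simp [left] <;> ring
    · rw [min_eq_right right]
      rcases j with _ | _ | j <;> simp [right.not_gt, neg_div]
  · have jump_eq :
        (if z.re < 0 ∧ -1 < z.im ∧ z.im < 1 then
          2 * I * Real.pi * z.re * (ultraspherical (-1 / 2) (j + 1) z.im : ℂ) else 0)
          = -(2 * Real.pi * I * (min z.re 0 : ℝ) *
            (if -1 ≤ z.im ∧ z.im < 1 then (legendrePrimitive j z.im : ℂ) else 0)) := by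
      simp only [him.symm.le_iff_lt, legendrePrimitive]
      rcases lt_or_ge z.re 0 with left | right
      · simp only [min_eq_left left.le, left, true_and, ofReal_neg]
        split_ifs <;> ring
      · simp [min_eq_right right, right.not_gt]
    rw [jump_eq, sub_neg_eq_add, add_left_inj]
    rcases j with _ | _ | j
    · simp [him]
    · simp only [zero_add, one_ne_zero, if_false, if_true]
      ring
    · simp

theorem cutRow_eq (z : ℂ) (k : ℕ) :
    cutRow z k = 2 * Real.pi * I *
      ((if z.re < 1 then ((ultraspherical (-3 / 2) (k + 2) 1 / 3 : ℝ) : ℂ) else 0)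
        - (if z.re < -1 then ((ultraspherical (-3 / 2) (k + 2) (-1) / 3 : ℝ) : ℂ) else 0)
        - if -1 ≤ z.re ∧ z.re < 1 then ((ultraspherical (-3 / 2) (k + 2) z.re / 3 : ℝ) : ℂ)
          else 0) := by
  rw [cutRow, integral_indicator_Ioi_deriv (by norm_num)
    (fun s => (hasDerivAt_ultraspherical_div_three k s).ofReal_comp) (by fun_prop)]

theorem beta_eq (k j : ℕ) (z : ℂ) :
    beta k j z = (cutRow z k + if k = 0 then 2 * Real.pi * I *
      ((min (z.re - 1) 0 : ℝ) + (min (z.re + 1) 0 : ℝ)) else 0)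
        * cutCol z j := by
  rw [beta, cutRow_eq, cutCol, legendrePrimitive]
  by_cases him : -1 ≤ z.im ∧ z.im < 1
  swap
  · simp [him]
  have at_one := ultraspherical_div_three_of_sq_eq_one (x := 1) (by norm_num) k
  have at_neg_one := ultraspherical_div_three_of_sq_eq_one (x := -1) (by norm_num) k
  have cast_div : (ultraspherical (-3 / 2) (k + 2) z.re / 3 : ℂ)
      = ((ultraspherical (-3 / 2) (k + 2) z.re / 3 : ℝ) : ℂ) := by
    rw [ofReal_div, ofReal_ofNat]
  simp only [him, at_one, at_neg_one, and_true, if_true]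
  rcases lt_or_ge z.re (-1) with left | not_left
  · have lt_one : z.re < 1 := by linarith
    rw [min_eq_left (by linarith), min_eq_left (by linarith)]
    simp only [left, lt_one, left.not_ge, false_and, if_true, if_false]
    rcases k with _ | _ | k <;> simp <;> ring
  rw [min_eq_right (a := z.re + 1) (by linarith)]
  rcases lt_trichotomy z.re 1 with inside | right_edge | right
  · rw [min_eq_left (by linarith)]
    simp only [inside, inside.le, not_left, not_left.not_gt, true_and, if_true, if_false]
    rcases k with _ | _ | k <;> simp <;> ring
  · rw [cast_div, right_edge, at_one]
    rcases k with _ | _ | k <;> norm_num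
  · rw [min_eq_right (by linarith)]
    simp [right.not_gt, right.not_ge, not_left.not_gt]

theorem F1_apply (z : ℂ) (k j : ℕ) :
    F1 z k j = (if k = 0 then I * verticalEdges z j + mu j (z - 1) + mu j (z + 1) else 0)
      + (if k = 1 ∧ j = 0 then -4 / 3 else 0) := by
  simp only [F1, of_apply, verticalEdges, primitiveMoment]
  by_cases hk : k = 0
  · simp only [hk, if_true, zero_ne_one, false_and, if_false]
    ring
  · simp [hk]

theorem F2_apply (z : ℂ) (k j : ℕ) :
    F2 z k j = (if j = 0 then horizontalEdges z k + lam k (z - I) + lam k (z + I) else 0)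
      + (if k = 0 ∧ j = 1 then -(4 * I) / 3 else 0) + beta k j z := by
  simp only [F2, of_apply, horizontalEdges, primitiveMoment]
  by_cases hj : j = 0
  · simp only [hj, if_true, zero_ne_one, and_false, if_false]
    ring
  · by_cases h : k = 0 ∧ j = 1
    · simp [h.1, h.2]
    · simp [hj, h]

theorem F_eq (z : ℂ) :
    F z = vecMulVec (horizontalEdges z) (Pi.single 0 1)
      + vecMulVec (Pi.single 0 1) (-I • verticalEdges z) + vecMulVec (cutRow z) (cutCol z) := by
  ext k j
  have cutCol_sub_one : cutCol (z - 1) j = cutCol z j := by simp [cutCol]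
  have cutCol_add_one : cutCol (z + 1) j = cutCol z j := by simp [cutCol]
  simp only [F, Matrix.sub_apply, Matrix.add_apply, F1_apply, F2_apply, mu_eq, beta_eq, lam,
    vecMulVec_apply, Pi.smul_apply, smul_eq_mul, cutCol_sub_one, cutCol_add_one,
    sub_re, add_re, one_re, sub_right_comm z I, sub_add_eq_add_sub z I, add_sub_right_comm z I,
    add_right_comm z I]
  rcases k with _ | _ | k <;> rcases j with _ | _ | j <;> simp <;> ring

theorem sylvester (z : ℂ) : infMul C (L z) - I • infMul (L z) Cᵀ = F z :=
  (infMul_C_L_sub z).trans (F_eq z).symm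

end RightHandSide

section Rank

theorem cRank_sum_vecMulVec_le {ι m n R : Type*} [Fintype ι] [CommRing R] [StrongRankCondition R]
    (u : ι → m → R) (v : ι → n → R) :
    (∑ i, vecMulVec (u i) (v i)).cRank ≤ Fintype.card ι := by
  have col_mem (j : n) : (∑ i, vecMulVec (u i) (v i)).col j ∈ Submodule.span R (range u) := by
    have col_eq : (∑ i, vecMulVec (u i) (v i)).col j = ∑ i, v i j • u i := by
      ext k
      simp [Matrix.sum_apply, vecMulVec_apply, mul_comm]
    rw [col_eq]
    exact Submodule.sum_mem _ fun i _ =>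
      Submodule.smul_mem _ _ (Submodule.subset_span (mem_range_self i))
  refine (Submodule.rank_mono (Submodule.span_le.2 (range_subset_iff.2 col_mem))).trans ?_
  exact (rank_span_le _).trans (by simpa using Cardinal.mk_range_le_lift (f := u))

theorem cRank_F_le (z : ℂ) : (F z).cRank ≤ 3 := by
  have F_eq_sum : F z = ∑ i, vecMulVec (![horizontalEdges z, Pi.single 0 1, cutRow z] i)
      (![Pi.single 0 1, -I • verticalEdges z, cutCol z] i) := by
    rw [F_eq, Fin.sum_univ_three]
    rfl
  rw [F_eq_sum]
  exact (cRank_sum_vecMulVec_le _ _).trans (by simp)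

end Rank

end LogSquare

end

theorem mainTheorem1 :
    -- the explicit form of the tridiagonal matrix `C = A - B`
    (∀ k n : ℕ, LogSquare.C k n =
      if k = n + 1 then -1 / (2 * (k : ℂ) + 1)
      else if n = k + 1 then 1 / (2 * (k : ℂ) + 1)
      else 0) ∧
    ∀ z : ℂ,
      -- the entries of `L(z)` are absolutely convergent integrals
      (∀ k j : ℕ, MeasureTheory.IntegrableOn (LogSquare.logIntegrand k j z) LogSquare.square) ∧
      -- the Sylvester equation
      LogSquare.infMul LogSquare.C (LogSquare.L z)
          - Complex.I • LogSquare.infMul (LogSquare.L z) LogSquare.C.transpose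
        = LogSquare.F z ∧
      -- the rank bound
      (LogSquare.F z).cRank ≤ 3 :=
  ⟨LogSquare.C_apply, fun z =>
    ⟨fun k j => LogSquare.integrableOn_logIntegrand k j z, LogSquare.sylvester z,
      LogSquare.cRank_F_le z⟩⟩
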